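/- Let $G$ be a Feynman graph, with internal edges $e$ of mass $m_e$ and external edges $j$ of mass $M_j$, in space-time dimension $d\ge 1$. Let $\mathcal S(G_0)$ be the space of complex external momenta $p$ that conserve total momentum and satisfy $p_j^2=M_j^2$ for every $j$ (squares are Minkowski squares). For a set $\kappa$ of internal edges let $G^\kappa$ be the graph obtained from $G$ by contracting the edges in $\kappa$. The Pham locus $\mathcal P_\kappa\subset\mathcal S(G_0)$ is the set of those $p$ for which there are complex internal momenta $q_e$ on the edges of $G^\kappa$ that conserve momentum at every vertex, with $q_e^2=m_e^2$ for all $e$, and numbers $\alpha_e\in\mathbb C$, not all zero, such that $\sum_e b_e\alpha_e q_e=0$ for every cycle $b$ of $G^\kappa$. Let $\mathcal P=\mathcal P_\kappa$ and $\mathcal P'=\mathcal P_{\kappa'}$ be two Pham loci of $G$ that have codimension one and intersect tangentially at a point, that is: there are holomorphic local coordinates $(z_1,z_2,w)$, $w\in\mathbb C^k$, of $\mathcal S(G_0)$, centred at that point and defined on a neighbourhood $U$ of it, in which $\mathcal P\cap U=\{z_1=0\}$ and $\mathcal P'\cap U=\{z_1=z_2^2\}$. Let $r>0$ be such that the closed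 bidisc $|z_1|\le r^2$, $|z_2|\le 2r$, $w=0$ lies in the range of the coordinates (which holds for all small $r$). In $U^\circ=U\setminus(\mathcal P\cup\mathcal P')$, with base point $(r^2,0,0)$, consider the loops ($0\le u\le 1$) $$\gamma(u)=(r^2e^{2\pi i u},0,0),\qquad \eta_+'(u)=(r^2,r(1-e^{2\pi i u}),0),\qquad \eta_-'(u)=(r^2,r(e^{2\pi i u}-1),0).$$ Let $\alpha\circ\beta$ denote the loop $\beta$ followed by $\alpha$, and let $\eta_+,\eta_-$ be loops in $U^\circ$ around $\mathcal P$ with $\gamma=\eta_+'\circ\eta_+=\eta_-'\circ\eta_-$ in $\pi_1(U^\circ)$. (a) In $\pi_1(U^\circ)$ one has $\gamma\circ\eta_\pm'\circ\gamma^{-1}=\eta_\mp'$, and hence $\gamma=\eta_+'\circ\eta_+=\eta_-'\circ\eta_-=\eta_+\circ\eta_-'=\eta_-\circ\eta_+'$. The relations $\gamma\circ\eta_\pm'\circ\gamma^{-1}=\eta_\mp'$ hold likewise, for every $r>0$, for the loops $\gamma(u)=(r^2e^{2\pi iu},0)$, $\eta_\pm'(u)=(r^2,\pm r(1-e^{2\pi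 iu}))$ in $\pi_1\big(\mathbb C^2\setminus\{z_1(z_1-z_2^2)=0\}\big)$ with base point $(r^2,0)$. (b) Let $\mathcal O$ be the set of germs at the base point of holomorphic functions on $\mathcal S(G_0)$ that can be continued analytically along every path in $U^\circ$. For every loop $\delta$ in $U^\circ$ at the base point, analytic continuation along $\delta$ is a well-defined operator $\mathscr M_\delta:\mathcal O\to\mathcal O$, and for every $f\in\mathcal O$ $$\mathscr M_{\eta_+'}\mathscr M_{\eta_+}f=\mathscr M_{\eta_-'}\mathscr M_{\eta_-}f=\mathscr M_{\eta_+}\mathscr M_{\eta_-'}f=\mathscr M_{\eta_-}\mathscr M_{\eta_+'}f .$$ (c) In particular this holds for every branch $f$ at the base point of the Feynman integral $$I_G(p)=\lim_{\varepsilon\to0^+}\int\prod_c d^dk_c\prod_e\frac{1}{q_e(k,p)^2-m_e^2+i\varepsilon(|\vec q_e|^2+m_e^2)}$$ (the integrals being absolutely convergent for $\varepsilon>0$) that has no singularities in $U$ except on $\mathcal P\cup\mathcal P'$, that is, for which $f\in\mathcal O$. -/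

import Mathlib

open Filter Topology

noncomputable section

namespace Pham

/-! ### Feynman graphs, on-shell kinematics, Pham loci -/

/-- A Feynman graph: oriented internal edges (self-loops and multiple edges are allowed),
external edges attached to one vertex, and a mass for every edge. The sign of an external edge
is `1` if it starts on its vertex and `-1` if it ends there. -/
structure FeynmanGraph where
  /-- the vertices -/
  Vertex : Type
  /-- the internal edges -/
  IntEdge : Type
  /-- the external edges -/
  ExtEdge : Type
  [finVertex : Finite Vertex]
  [finInt : Fintype IntEdge]
  [finExt : Fintype ExtEdge]
  /-- the vertex on which an internal edge starts -/
  src : IntEdge → Vertex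
  /-- the vertex on which an internal edge ends -/
  tgt : IntEdge → Vertex
  /-- the vertex of an external edge -/
  root : ExtEdge → Vertex
  /-- the orientation of an external edge -/
  sign : ExtEdge → ℤˣ
  /-- the mass of an internal edge -/
  mass : IntEdge → ℝ
  /-- the mass of an external edge -/
  extMass : ExtEdge → ℝ

attribute [instance] FeynmanGraph.finVertex FeynmanGraph.finInt FeynmanGraph.finExt

/-- The Minkowski square `q² = (q⁰)² - (q¹)² - ⋯ - (q^D)²` in space-time dimension `D + 1`. -/
def minkowskiSq {R : Type*} [CommRing R] {D : ℕ} (q : Fin (D + 1) → R) : R :=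
  q 0 ^ 2 - ∑ i : Fin D, q i.succ ^ 2

namespace FeynmanGraph

/-- The entry of the incidence matrix at a vertex and an internal edge (`0` for a self-loop). -/
def incidence (G : FeynmanGraph) (v : G.Vertex) (e : G.IntEdge) : ℤ :=
  open Classical in (if G.src e = v then 1 else 0) - (if G.tgt e = v then 1 else 0)

/-- The entry of the incidence matrix at a vertex and an external edge. -/
def extIncidence (G : FeynmanGraph) (v : G.Vertex) (e : G.ExtEdge) : ℤ :=
  open Classical in if G.root e = v then (G.sign e : ℤ) else 0

/-- Momentum conservation at every vertex, for internal momenta `q` and external momenta `p`. -/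
def Conserves {R : Type*} [CommRing R] {D : ℕ} (G : FeynmanGraph)
    (q : G.IntEdge → Fin (D + 1) → R) (p : G.ExtEdge → Fin (D + 1) → R) : Prop :=
  ∀ v μ, ∑ e, (G.incidence v e : R) * q e μ + ∑ e, (G.extIncidence v e : R) * p e μ = 0

/-- The lattice of cycles of `G`: integral combinations of internal edges without boundary. The
rows of the circuit matrix of a system of fundamental cycles are a `ℤ`-basis of it. -/
def cycles (G : FeynmanGraph) : Submodule ℤ (G.IntEdge → ℤ) where
  carrier := {b | ∀ v, ∑ e, G.incidence v e * b e = 0}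
  add_mem' := by
    intro a b ha hb v
    simp only [Pi.add_apply, mul_add, Finset.sum_add_distrib, ha v, hb v, add_zero]
  zero_mem' := by intro v; simp
  smul_mem' := by
    intro n b hb v
    have h : ∑ e, G.incidence v e * (n • b) e = n * ∑ e, G.incidence v e * b e := by
      rw [Finset.mul_sum]
      refine Finset.sum_congr rfl fun e _ => ?_
      simp only [Pi.smul_apply, smul_eq_mul]
      ring
    rw [h, hb v, mul_zero]

/-- The graph obtained by contracting the internal edges in `κ`: the end points of every edge
in `κ` are identified, and the edges in `κ` are deleted. -/
def contract (G : FeynmanGraph) (κ : Set G.IntEdge) : FeynmanGraph where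
  Vertex := Quot fun v w : G.Vertex => ∃ e ∈ κ, G.src e = v ∧ G.tgt e = w
  IntEdge := {e : G.IntEdge // e ∉ κ}
  ExtEdge := G.ExtEdge
  finInt := Fintype.ofFinite _
  src e := Quot.mk _ (G.src e)
  tgt e := Quot.mk _ (G.tgt e)
  root e := Quot.mk _ (G.root e)
  sign := G.sign
  mass e := G.mass e
  extMass := G.extMass

/-- The space of complex on-shell external momenta, that is the on-shell variety of the
elementary graph, in which all external edges of `G` meet at a single vertex. -/
def externalSpace (G : FeynmanGraph) (D : ℕ) : Set (G.ExtEdge → Fin (D + 1) → ℂ) :=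
  {p | (∀ μ, ∑ e, ((G.sign e : ℤ) : ℂ) * p e μ = 0) ∧
    ∀ e, minkowskiSq (p e) = (G.extMass e : ℂ) ^ 2}

/-- The external momenta at which all internal edges of `G` can be put on shell so that the
Landau loop equations hold for some Feynman parameters `α`, not all zero. -/
def landauLocus (G : FeynmanGraph) (D : ℕ) : Set (G.ExtEdge → Fin (D + 1) → ℂ) :=
  {p | p ∈ G.externalSpace D ∧ ∃ (q : G.IntEdge → Fin (D + 1) → ℂ) (α : G.IntEdge → ℂ),
    G.Conserves q p ∧ (∀ e, minkowskiSq (q e) = (G.mass e : ℂ) ^ 2) ∧ α ≠ 0 ∧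
    ∀ b ∈ G.cycles, ∀ μ, ∑ e, (b e : ℂ) * α e * q e μ = 0}

/-- The Pham locus of the contraction of `G / κ` to the elementary graph. -/
def phamLocus (G : FeynmanGraph) (D : ℕ) (κ : Set G.IntEdge) :
    Set (G.ExtEdge → Fin (D + 1) → ℂ) :=
  (G.contract κ).landauLocus D

end FeynmanGraph

/-! ### Analytic continuation and monodromy on a subset of a complex vector space -/

section Continuation

variable {E : Type*} [NormedAddCommGroup E] [NormedSpace ℂ E]

/-- `f` is holomorphic on `X` near `x`: near `x` it is the restriction to `X` of a holomorphic
function of the ambient space. -/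
def HolomorphicGerm (X : Set E) (f : E → ℂ) (x : E) : Prop :=
  ∃ g : E → ℂ, AnalyticAt ℂ g x ∧ f =ᶠ[𝓝[X] x] g

/-- The germ `g` is the result of analytic continuation, on `X`, of the germ `f` along the path
`δ` (which runs in a subset `U` of `X`). -/
def IsContinuation (X : Set E) {U : Set E} {x y : U} (δ : Path x y)
    (f : Germ (𝓝[X] (x : E)) ℂ) (g : Germ (𝓝[X] (y : E)) ℂ) : Prop :=
  ∃ F : unitInterval → E → ℂ,
    (∀ t, HolomorphicGerm X (F t) (δ t : E)) ∧
    (∀ t, ∀ᶠ s in 𝓝 t, F s =ᶠ[𝓝[X] (δ s : E)] F t) ∧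
    (F 0 : Germ (𝓝[X] (x : E)) ℂ) = f ∧ (F 1 : Germ (𝓝[X] (y : E)) ℂ) = g

/-- The multivalued holomorphic functions on `U ⊆ X`: the germs at the base point `x` that can
be continued analytically along every path in `U`. -/
def multivalued (X : Set E) {U : Set E} (x : U) : Set (Germ (𝓝[X] (x : E)) ℂ) :=
  {f | ∀ (y : U) (δ : Path x y), ∃ g, IsContinuation X δ f g}

/-- The monodromy operator of a loop: analytic continuation along the loop. -/
def monodromy (X : Set E) {U : Set E} {x : U} (δ : Path x x)
    (f : Germ (𝓝[X] (x : E)) ℂ) : Germ (𝓝[X] (x : E)) ℂ :=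
  Classical.epsilon fun g => IsContinuation X δ f g

end Continuation

/-! ### The Feynman integral and its branches -/

namespace FeynmanGraph

/-- The propagator of a real momentum, with the `iε` in the form `iε (|q⃗|² + m²)`, which makes
the momentum integrals absolutely convergent whenever there is no ultraviolet divergence. -/
def propagator {D : ℕ} (m ε : ℝ) (q : Fin (D + 1) → ℝ) : ℂ :=
  1 / (((minkowskiSq q - m ^ 2 : ℝ) : ℂ) +
    Complex.I * ((ε * ((∑ i : Fin D, q i.succ ^ 2) + m ^ 2) : ℝ) : ℂ))

/-- `I` is the value of the Feynman integral of `G` at real external momenta `p`. Here `b` is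
the circuit matrix of a basis of cycles, and the internal momenta are
`q e = q₀ e + ∑ c, b c e * k c`, where `q₀` conserves momentum and `k` are the loop momenta. -/
def IsFeynmanIntegral {D : ℕ} (G : FeynmanGraph) (p : G.ExtEdge → Fin (D + 1) → ℝ)
    (I : ℂ) : Prop :=
  ∃ (ℓ : ℕ) (b : Fin ℓ → G.IntEdge → ℤ) (q₀ : G.IntEdge → Fin (D + 1) → ℝ),
    LinearIndependent ℤ b ∧ Submodule.span ℤ (Set.range b) = G.cycles ∧ G.Conserves q₀ p ∧
    (∀ ε : ℝ, 0 < ε → MeasureTheory.Integrable fun k : Fin ℓ → Fin (D + 1) → ℝ =>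
      ∏ e, propagator (G.mass e) ε (fun μ => q₀ e μ + ∑ c, (b c e : ℝ) * k c μ)) ∧
    Tendsto (fun ε : ℝ => ∫ k : Fin ℓ → Fin (D + 1) → ℝ,
      ∏ e, propagator (G.mass e) ε (fun μ => q₀ e μ + ∑ c, (b c e : ℝ) * k c μ))
      (𝓝[>] 0) (𝓝 I)

/-- The complexification of real external momenta. -/
def complexify {D : ℕ} {G : FeynmanGraph} (p : G.ExtEdge → Fin (D + 1) → ℝ) :
    G.ExtEdge → Fin (D + 1) → ℂ :=
  fun e μ => (p e μ : ℂ)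

/-- The germ `f` is a branch of the Feynman integral of `G` at `x`: it arises by analytic
continuation on the space of external kinematics from a real point, near which the function
takes the values of the Feynman integral at the real points. -/
def IsFeynmanBranch {D : ℕ} (G : FeynmanGraph) (x : G.ExtEdge → Fin (D + 1) → ℂ)
    (f : Germ (𝓝[G.externalSpace D] x) ℂ) : Prop :=
  ∃ (p₀ : G.ExtEdge → Fin (D + 1) → ℝ) (h₀ : complexify p₀ ∈ G.externalSpace D)
    (h : x ∈ G.externalSpace D)
    (δ : Path (⟨complexify p₀, h₀⟩ : G.externalSpace D) (⟨x, h⟩ : G.externalSpace D))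
    (F : (G.ExtEdge → Fin (D + 1) → ℂ) → ℂ),
    (∀ᶠ p in 𝓝 p₀, complexify p ∈ G.externalSpace D →
      G.IsFeynmanIntegral p (F (complexify p))) ∧
    IsContinuation (G.externalSpace D) δ
      (F : Germ (𝓝[G.externalSpace D] (complexify p₀)) ℂ) f

end FeynmanGraph

/-! ### The line and the parabola -/

/-- The complement in `ℂ²` of the line `z₁ = 0` and the parabola `z₁ = z₂²`. -/
def lineParabolaComplement : Set (ℂ × ℂ) := {z | z.1 ≠ 0 ∧ z.1 ≠ z.2 ^ 2}

/-- The part of the complement in the closed bidisc `|z₁| ≤ r²`, `|z₂| ≤ 2r`. -/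
def modelRegion (r : ℝ) : Set (ℂ × ℂ) :=
  {z | (‖z.1‖ ≤ r ^ 2 ∧ ‖z.2‖ ≤ 2 * r) ∧ z ∈ lineParabolaComplement}

/-- The point `exp (2 π i u)` of the unit circle. -/
def circlePoint (u : unitInterval) : ℂ := Complex.exp (2 * Real.pi * Complex.I * (u : ℝ))

theorem norm_circlePoint (u : unitInterval) : ‖circlePoint u‖ = 1 := by
  have h : (2 * Real.pi * Complex.I * ((u : ℝ) : ℂ)) =
      ((2 * Real.pi * (u : ℝ) : ℝ) : ℂ) * Complex.I := by push_cast; ring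
  rw [circlePoint, h, Complex.norm_exp_ofReal_mul_I]

theorem circlePoint_ne_zero (u : unitInterval) : circlePoint u ≠ 0 := Complex.exp_ne_zero _

theorem circlePoint_ne_two (u : unitInterval) : circlePoint u ≠ 2 := by
  intro h
  have h1 := norm_circlePoint u
  rw [h] at h1
  norm_num at h1

theorem continuous_circlePoint : Continuous circlePoint := by
  unfold circlePoint
  fun_prop

theorem circlePoint_zero : circlePoint 0 = 1 := by simp [circlePoint]

theorem circlePoint_one : circlePoint 1 = 1 := by
  simp [circlePoint, Complex.exp_two_pi_mul_I]

theorem gamma_mem {r : ℝ} (hr : 0 < r) (u : unitInterval) :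
    (((r : ℂ) ^ 2 * circlePoint u, 0) : ℂ × ℂ) ∈ modelRegion r := by
  have hr0 : (r : ℂ) ≠ 0 := by exact_mod_cast hr.ne'
  have hne : (r : ℂ) ^ 2 * circlePoint u ≠ 0 :=
    mul_ne_zero (pow_ne_zero 2 hr0) (circlePoint_ne_zero u)
  refine ⟨⟨?_, ?_⟩, hne, ?_⟩
  · simp [norm_circlePoint]
  · simp only [norm_zero]; positivity
  · simpa using hne

theorem eta_mem {r : ℝ} (hr : 0 < r) {s : ℂ} (hs : s ^ 2 = 1) (u : unitInterval) :
    (((r : ℂ) ^ 2, (r : ℂ) * (s * (1 - circlePoint u))) : ℂ × ℂ) ∈ modelRegion r := by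
  have hr0 : (r : ℂ) ≠ 0 := by exact_mod_cast hr.ne'
  have hs1 : ‖s‖ = 1 := by
    have h : ‖s‖ ^ 2 = 1 := by rw [← norm_pow, hs, norm_one]
    exact (pow_eq_one_iff_of_nonneg (norm_nonneg s) two_ne_zero).1 h
  refine ⟨⟨?_, ?_⟩, pow_ne_zero 2 hr0, ?_⟩
  · simp
  · have h1 : ‖1 - circlePoint u‖ ≤ 2 := by
      refine (norm_sub_le _ _).trans ?_
      rw [norm_one, norm_circlePoint]; norm_num
    simp only [norm_mul, hs1, one_mul, Complex.norm_real, Real.norm_eq_abs, abs_of_pos hr]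
    nlinarith
  · intro h
    simp only at h
    have h2 : (r : ℂ) ^ 2 * (circlePoint u * (circlePoint u - 2)) = 0 := by
      linear_combination -h - (r : ℂ) ^ 2 * (1 - circlePoint u) ^ 2 * hs
    rcases mul_eq_zero.1 h2 with h3 | h3
    · exact pow_ne_zero 2 hr0 h3
    · rcases mul_eq_zero.1 h3 with h4 | h4
      · exact circlePoint_ne_zero u h4
      · exact circlePoint_ne_two u (sub_eq_zero.1 h4)

/-- The base point `(r², 0)`. -/
def modelBase {r : ℝ} (hr : 0 < r) : modelRegion r :=
  ⟨((r : ℂ) ^ 2, 0), by simpa [circlePoint_zero] using gamma_mem hr 0⟩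

/-- The loop `γ(u) = (r² exp (2 π i u), 0)`, around the line and the parabola. -/
def modelGamma {r : ℝ} (hr : 0 < r) : Path (modelBase hr) (modelBase hr) where
  toFun u := ⟨((r : ℂ) ^ 2 * circlePoint u, 0), gamma_mem hr u⟩
  continuous_toFun := by
    have := continuous_circlePoint
    fun_prop
  source' := by simp [modelBase, circlePoint_zero]
  target' := by simp [modelBase, circlePoint_one]

/-- The loop `η₊'(u) = (r², r (1 - exp (2 π i u)))`, around the branch `z₂ = √z₁` of the
parabola. -/
def modelEtaPlus {r : ℝ} (hr : 0 < r) : Path (modelBase hr) (modelBase hr) where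
  toFun u := ⟨((r : ℂ) ^ 2, (r : ℂ) * (1 - circlePoint u)), by
    simpa using eta_mem hr (s := 1) (by norm_num) u⟩
  continuous_toFun := by
    have := continuous_circlePoint
    fun_prop
  source' := by simp [modelBase, circlePoint_zero]
  target' := by simp [modelBase, circlePoint_one]

/-- The loop `η₋'(u) = (r², r (exp (2 π i u) - 1))`, around the branch `z₂ = -√z₁` of the
parabola. -/
def modelEtaMinus {r : ℝ} (hr : 0 < r) : Path (modelBase hr) (modelBase hr) where
  toFun u := ⟨((r : ℂ) ^ 2, (r : ℂ) * (circlePoint u - 1)), by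
    simpa using eta_mem hr (s := -1) (by norm_num) u⟩
  continuous_toFun := by
    have := continuous_circlePoint
    fun_prop
  source' := by simp [modelBase, circlePoint_zero]
  target' := by simp [modelBase, circlePoint_one]

/-- The inclusion of the bidisc part of the complement into the whole complement in `ℂ²`. -/
def modelIncl (r : ℝ) : C(modelRegion r, lineParabolaComplement) where
  toFun z := ⟨z, z.2.2⟩
  continuous_toFun := by fun_prop

/-! ### Tangential intersection of two hypersurfaces -/

section Tangential

variable {E : Type*} [NormedAddCommGroup E] [NormedSpace ℂ E]

/-- Holomorphic local coordinates `(z₁, z₂, w)` of `X`, centred at a point near which the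
codimension-one loci `P` and `P'` intersect tangentially: in these coordinates, `P` is the
hypersurface `z₁ = 0` and `P'` is the hypersurface `z₁ = z₂²`. The coordinates are a
biholomorphic map from `X ∩ source`, an open subset of `X`, onto the open set `target`. -/
structure TangentialChart (X P P' : Set E) (k : ℕ) where
  /-- an open subset of the ambient space -/
  source : Set E
  /-- the range of the coordinates -/
  target : Set (ℂ × ℂ × (Fin k → ℂ))
  /-- the coordinates -/
  coord : E → ℂ × ℂ × (Fin k → ℂ)
  /-- the inverse map -/
  param : ℂ × ℂ × (Fin k → ℂ) → E
  isOpen_source : IsOpen source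
  isOpen_target : IsOpen target
  coord_mem : ∀ x ∈ X ∩ source, coord x ∈ target
  param_mem : ∀ z ∈ target, param z ∈ X ∩ source
  param_coord : ∀ x ∈ X ∩ source, param (coord x) = x
  coord_param : ∀ z ∈ target, coord (param z) = z
  analytic_coord : AnalyticOnNhd ℂ coord source
  analytic_param : AnalyticOnNhd ℂ param target
  zero_mem : 0 ∈ target
  mem_line_iff : ∀ x ∈ X ∩ source, x ∈ P ↔ (coord x).1 = 0
  mem_parabola_iff : ∀ x ∈ X ∩ source, x ∈ P' ↔ (coord x).1 = (coord x).2.1 ^ 2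

namespace TangentialChart

variable {X P P' : Set E} {k : ℕ}

/-- The complement of the two loci in the coordinate neighbourhood. -/
def complement (c : TangentialChart X P P' k) : Set E := (X ∩ c.source) \ (P ∪ P')

/-- The closed bidisc `|z₁| ≤ r²`, `|z₂| ≤ 2r`, `w = 0` lies in the coordinate neighbourhood
(which is the case for every small `r > 0`). -/
def Fits (c : TangentialChart X P P' k) (r : ℝ) : Prop :=
  0 < r ∧ ∀ z₁ z₂ : ℂ, ‖z₁‖ ≤ r ^ 2 → ‖z₂‖ ≤ 2 * r → (z₁, z₂, 0) ∈ c.target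

/-- The map that sends `(z₁, z₂)` to the point with coordinates `(z₁, z₂, 0)`. -/
def embed (c : TangentialChart X P P' k) {r : ℝ} (hr : c.Fits r) :
    C(modelRegion r, c.complement) where
  toFun z := ⟨c.param (z.1.1, z.1.2, 0), by
    have hz := hr.2 _ _ z.2.1.1 z.2.1.2
    have hx := c.param_mem _ hz
    refine ⟨hx, ?_⟩
    rintro (h | h)
    · rw [c.mem_line_iff _ hx, c.coord_param _ hz] at h
      exact z.2.2.1 h
    · rw [c.mem_parabola_iff _ hx, c.coord_param _ hz] at h
      exact z.2.2.2 h⟩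
  continuous_toFun := by
    refine Continuous.subtype_mk ?_ _
    refine c.analytic_param.continuousOn.comp_continuous (by fun_prop) ?_
    exact fun z => hr.2 _ _ z.2.1.1 z.2.1.2

/-- The base point, with coordinates `(r², 0, 0)`. -/
def base (c : TangentialChart X P P' k) {r : ℝ} (hr : c.Fits r) : c.complement :=
  c.embed hr (modelBase hr.1)

/-- The loop `γ` in the complement of the two loci. -/
def gamma (c : TangentialChart X P P' k) {r : ℝ} (hr : c.Fits r) :
    Path (c.base hr) (c.base hr) :=
  (modelGamma hr.1).map (c.embed hr).continuous

/-- The loop `η₊'` around the branch `z₂ = √z₁` of `P'`. -/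
def etaPlus (c : TangentialChart X P P' k) {r : ℝ} (hr : c.Fits r) :
    Path (c.base hr) (c.base hr) :=
  (modelEtaPlus hr.1).map (c.embed hr).continuous

/-- The loop `η₋'` around the branch `z₂ = -√z₁` of `P'`. -/
def etaMinus (c : TangentialChart X P P' k) {r : ℝ} (hr : c.Fits r) :
    Path (c.base hr) (c.base hr) :=
  (modelEtaMinus hr.1).map (c.embed hr).continuous

end TangentialChart

end Tangential

/-- `γ ∘ η ∘ γ⁻¹ = η'` in the fundamental group, where `α ∘ β` means: first `β`, then `α`
(while in `β.trans α` the path on the left comes first). -/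
def ConjRel {Y : Type*} [TopologicalSpace Y] {x : Y} (γ η η' : Path x x) : Prop :=
  Path.Homotopic ((γ.symm.trans η).trans γ) η'

end Pham

end

open Filter Topology

namespace Pham

/-! ### Conjugation by a loop that drags the base point -/

/-! The weighted rotation `(z₁, z₂) ↦ (exp (2πit) z₁, exp (πit) z₂)` preserves the line, the
parabola and the bidisc. As `t` runs from `0` to `1`, it carries the base point `(r², 0)` once
through `γ` and ends at `(z₁, z₂) ↦ (z₁, -z₂)`, which exchanges `η₊'` and `η₋'`. A free homotopy
whose base point traces `γ` amounts to conjugation by `γ` (`ConjRel.of_square`), so `γ ∘ η±' ∘ γ⁻¹ =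
η∓'`. The map `embed` transports this to the complement of the Pham loci, and the other
factorizations of `γ` follow by group theory (`ConjRel.trans_homotopic`).

For the monodromies it remains to see that continuation is functorial: it is unique, depends only on
the homotopy class of the path (`IsContinuation.eq_of_homotopic`), and respects concatenation. The
on-shell space is only a subset of a vector space, so the arguments are based on a local identity
principle for germs, which the chart provides (`TangentialChart.identityPrinciple`). All four
products of operators are then the monodromy along `γ`. -/

instance contractibleSpace_unitInterval : ContractibleSpace unitInterval :=
  (convex_Icc (0 : ℝ) 1).contractibleSpace ⟨0, by simp⟩

/-- The loop `η` is freely homotopic to `η'`, in such a way that the base point runs through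
the loop `γ`. -/
theorem ConjRel.of_square {Y : Type*} [TopologicalSpace Y] {x : Y} {γ η η' : Path x x}
    (H : C(unitInterval × unitInterval, Y)) (h₀ : ∀ u, H (0, u) = η u)
    (h₁ : ∀ u, H (1, u) = η' u) (hl : ∀ t, H (t, 0) = γ t) (hr : ∀ t, H (t, 1) = γ t) :
    ConjRel γ η η' := by
  have key : (η.trans γ).Homotopic (γ.trans η') := by
    let a : Path ((0, 0) : unitInterval × unitInterval) (0, 1) :=
      ⟨⟨fun u => (0, u), by fun_prop⟩, rfl, rfl⟩
    let b : Path ((0, 1) : unitInterval × unitInterval) (1, 1) :=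
      ⟨⟨fun u => (u, 1), by fun_prop⟩, rfl, rfl⟩
    let c : Path ((0, 0) : unitInterval × unitInterval) (1, 0) :=
      ⟨⟨fun u => (u, 0), by fun_prop⟩, rfl, rfl⟩
    let d : Path ((1, 0) : unitInterval × unitInterval) (1, 1) :=
      ⟨⟨fun u => (1, u), by fun_prop⟩, rfl, rfl⟩
    -- The square is contractible, so the two ways around its boundary from corner to opposite
    -- corner are homotopic; `H` maps them to `η` then `γ`, and `γ` then `η'`.
    have h := (SimplyConnectedSpace.paths_homotopic (a.trans b) (c.trans d)).map H
    rw [Path.map_trans, Path.map_trans] at h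
    -- The corners go to `x` only up to a propositional equality, hence the casts.
    have e00 : x = H (0, 0) := by rw [h₀, η.source]
    have e01 : x = H (0, 1) := by rw [h₀, η.target]
    have e10 : x = H (1, 0) := by rw [h₁, η'.source]
    have e11 : x = H (1, 1) := by rw [h₁, η'.target]
    have ha : η = (a.map H.continuous).cast e00 e01 := by ext u; exact (h₀ u).symm
    have hb : γ = (b.map H.continuous).cast e01 e11 := by ext u; exact (hr u).symm
    have hc : γ = (c.map H.continuous).cast e00 e10 := by ext u; exact (hl u).symm
    have hd : η' = (d.map H.continuous).cast e10 e11 := by ext u; exact (h₁ u).symm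
    have e1 : η.trans γ = ((a.map H.continuous).trans (b.map H.continuous)).cast e00 e11 := by
      rw [ha, hb]; rfl
    have e2 : γ.trans η' = ((c.map H.continuous).trans (d.map H.continuous)).cast e00 e11 := by
      rw [hd, hc]; rfl
    rw [e1, e2]
    exact h.pathCast e00 e11
  unfold ConjRel
  rw [← Path.Homotopic.Quotient.eq] at key ⊢
  simp only [Path.Homotopic.Quotient.mk_trans, Path.Homotopic.Quotient.mk_symm] at key ⊢
  rw [Path.Homotopic.Quotient.trans_assoc, key, ← Path.Homotopic.Quotient.trans_assoc,
    Path.Homotopic.Quotient.symm_trans, Path.Homotopic.Quotient.refl_trans]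

theorem ConjRel.map {Y Z : Type*} [TopologicalSpace Y] [TopologicalSpace Z] {x : Y}
    {γ η η' : Path x x} (h : ConjRel γ η η') (f : C(Y, Z)) :
    ConjRel (γ.map f.continuous) (η.map f.continuous) (η'.map f.continuous) := by
  have := Path.Homotopic.map h f
  rwa [Path.map_trans, Path.map_trans, ← Path.map_symm] at this

/-- If `γ ∘ η' ∘ γ⁻¹ = η` and `γ = η ∘ ρ`, then `γ = ρ ∘ η'`. -/
theorem ConjRel.trans_homotopic {Y : Type*} [TopologicalSpace Y] {x : Y} {γ η η' ρ : Path x x}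
    (h : ConjRel γ η' η) (hρ : (ρ.trans η).Homotopic γ) : (η'.trans ρ).Homotopic γ := by
  unfold ConjRel at h
  rw [← Path.Homotopic.Quotient.eq] at h hρ ⊢
  simp only [Path.Homotopic.Quotient.mk_trans, Path.Homotopic.Quotient.mk_symm] at h hρ ⊢
  generalize Path.Homotopic.Quotient.mk γ = c at *
  generalize Path.Homotopic.Quotient.mk η = a at *
  generalize Path.Homotopic.Quotient.mk η' = b at *
  generalize Path.Homotopic.Quotient.mk ρ = s at *
  -- With products in path order: `b c = c a` and `s = c a⁻¹` give `b s = c a a⁻¹ = c`.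
  have h1 : b.trans c = c.trans a := by
    rw [← h, ← Path.Homotopic.Quotient.trans_assoc, ← Path.Homotopic.Quotient.trans_assoc,
      Path.Homotopic.Quotient.trans_symm, Path.Homotopic.Quotient.refl_trans]
  have h2 : s = c.trans a.symm := by
    rw [← hρ, Path.Homotopic.Quotient.trans_assoc, Path.Homotopic.Quotient.trans_symm,
      Path.Homotopic.Quotient.trans_refl]
  rw [h2, ← Path.Homotopic.Quotient.trans_assoc, h1, Path.Homotopic.Quotient.trans_assoc,
    Path.Homotopic.Quotient.trans_symm, Path.Homotopic.Quotient.trans_refl]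

/-! ### The relations in the model -/

/-- The point `exp (π i u)`, a square root of `circlePoint u`. -/
noncomputable def halfCirclePoint (u : unitInterval) : ℂ := Complex.exp (Real.pi * Complex.I * (u : ℝ))

theorem halfCirclePoint_sq (u : unitInterval) : halfCirclePoint u ^ 2 = circlePoint u := by
  rw [halfCirclePoint, circlePoint, ← Complex.exp_nat_mul]
  congr 1
  push_cast
  ring

theorem norm_halfCirclePoint (u : unitInterval) : ‖halfCirclePoint u‖ = 1 := by
  have h : ‖halfCirclePoint u‖ ^ 2 = 1 := by
    rw [← norm_pow, halfCirclePoint_sq, norm_circlePoint]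
  exact (pow_eq_one_iff_of_nonneg (norm_nonneg _) two_ne_zero).1 h

theorem continuous_halfCirclePoint : Continuous halfCirclePoint := by
  unfold halfCirclePoint
  fun_prop

/-- The rotation preserves both absolute values and multiplies `z₁ - z₂²` by `circlePoint t`, which
does not vanish. -/
theorem rotated_eta_mem {r : ℝ} (hr : 0 < r) {s : ℂ} (hs : s ^ 2 = 1) (t u : unitInterval) :
    (((r : ℂ) ^ 2 * circlePoint t, (r : ℂ) * (halfCirclePoint t * (s * (1 - circlePoint u)))) :
      ℂ × ℂ) ∈ modelRegion r := by
  obtain ⟨⟨-, h2⟩, h3, h4⟩ := eta_mem hr hs u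
  have hc := circlePoint_ne_zero t
  refine ⟨⟨?_, ?_⟩, mul_ne_zero h3 hc, ?_⟩
  · simp [norm_circlePoint]
  · simpa [norm_halfCirclePoint] using h2
  · intro h
    refine h4 (mul_right_cancel₀ hc ?_)
    simp only at h ⊢
    rw [h, ← halfCirclePoint_sq t]
    ring

theorem coe_modelGamma {r : ℝ} (hr : 0 < r) (u : unitInterval) :
    (modelGamma hr u : ℂ × ℂ) = ((r : ℂ) ^ 2 * circlePoint u, 0) := rfl

theorem coe_modelEtaPlus {r : ℝ} (hr : 0 < r) (u : unitInterval) :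
    (modelEtaPlus hr u : ℂ × ℂ) = ((r : ℂ) ^ 2, (r : ℂ) * (1 - circlePoint u)) := rfl

theorem coe_modelEtaMinus {r : ℝ} (hr : 0 < r) (u : unitInterval) :
    (modelEtaMinus hr u : ℂ × ℂ) = ((r : ℂ) ^ 2, (r : ℂ) * (circlePoint u - 1)) := rfl

/-- The rotated loops form the square: at `t = 1` the factor `halfCirclePoint t` is `-1` and turns
`s` into `-s`; at `u = 0, 1` the second coordinate vanishes, so the sides run through `γ`. The sign
`s = ±1` covers both relations. -/
theorem conjRel_model {r : ℝ} (hr : 0 < r) {s : ℂ} (hs : s ^ 2 = 1)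
    {η η' : Path (modelBase hr) (modelBase hr)}
    (hη : ∀ u, (η u : ℂ × ℂ) = ((r : ℂ) ^ 2, (r : ℂ) * (s * (1 - circlePoint u))))
    (hη' : ∀ u, (η' u : ℂ × ℂ) = ((r : ℂ) ^ 2, (r : ℂ) * (-s * (1 - circlePoint u)))) :
    ConjRel (modelGamma hr) η η' := by
  have c1 := continuous_circlePoint
  have c2 := continuous_halfCirclePoint
  refine ConjRel.of_square
    ⟨fun p => ⟨((r : ℂ) ^ 2 * circlePoint p.1,
      (r : ℂ) * (halfCirclePoint p.1 * (s * (1 - circlePoint p.2)))),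
      rotated_eta_mem hr hs p.1 p.2⟩, by fun_prop⟩ ?_ ?_ ?_ ?_
  · intro u
    apply Subtype.ext
    rw [hη]
    simp [circlePoint_zero, halfCirclePoint]
  · intro u
    apply Subtype.ext
    rw [hη']
    simp [circlePoint_one, halfCirclePoint]
  · intro t
    apply Subtype.ext
    simp [circlePoint_zero, coe_modelGamma]
  · intro t
    apply Subtype.ext
    simp [circlePoint_one, coe_modelGamma]

theorem conjRel_modelEtaPlus {r : ℝ} (hr : 0 < r) :
    ConjRel (modelGamma hr) (modelEtaPlus hr) (modelEtaMinus hr) :=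
  conjRel_model hr (s := 1) (by norm_num) (fun u => by simp [coe_modelEtaPlus])
    (fun u => by simp [coe_modelEtaMinus])

theorem conjRel_modelEtaMinus {r : ℝ} (hr : 0 < r) :
    ConjRel (modelGamma hr) (modelEtaMinus hr) (modelEtaPlus hr) :=
  conjRel_model hr (s := -1) (by norm_num) (fun u => by simp [coe_modelEtaMinus])
    (fun u => by simp [coe_modelEtaPlus])

/-! ### Uniqueness of analytic continuation and the monodromy theorem -/

/-- A locally constant property is constant on a connected set. Both uniqueness of continuation and
the monodromy theorem reduce to this. -/
theorem _root_.IsPreconnected.of_eventually_iff {α : Type*} [TopologicalSpace α] {T : Set α}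
    (hT : IsPreconnected T) {P : α → Prop} (h : ∀ t ∈ T, ∀ᶠ s in 𝓝[T] t, (P s ↔ P t))
    {a b : α} (ha : a ∈ T) (hb : b ∈ T) (hP : P a) : P b :=
  (hT.induction₂ (fun s t => (P s ↔ P t)) (fun t ht => (h t ht).mono fun _ hs => hs.symm)
    (fun _ _ _ _ _ _ h₁ h₂ => h₁.trans h₂) (fun _ _ _ _ h => h.symm) ha hb).1 hP

theorem tendsto_nhdsWithin_of_continuous {α E : Type*} [TopologicalSpace α]
    [TopologicalSpace E] {X : Set E} {δ : α → E}
    (hδ : Continuous δ) (hX : ∀ t, δ t ∈ X) (t : α) : Tendsto δ (𝓝 t) (𝓝[X] (δ t)) :=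
  tendsto_nhdsWithin_iff.2 ⟨hδ.continuousAt, .of_forall hX⟩

theorem continuous_coe_path {E : Type*} [TopologicalSpace E] {U : Set E} {x y : U}
    (δ : Path x y) : Continuous fun t => (δ t : E) :=
  continuous_subtype_val.comp δ.continuous

section Continuation

variable {E : Type*} [NormedAddCommGroup E] [NormedSpace ℂ E]

/-- The identity principle on `X` at the points of `U`: close to such a point, two holomorphic
germs agree either everywhere or nowhere. -/
def IdentityPrinciple (X U : Set E) : Prop :=
  ∀ x ∈ U, ∀ f g : E → ℂ, HolomorphicGerm X f x → HolomorphicGerm X g x →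
    ∀ᶠ y in 𝓝[X] x, (f =ᶠ[𝓝[X] y] g ↔ f =ᶠ[𝓝[X] x] g)

theorem HolomorphicGerm.eventually {X : Set E} {f : E → ℂ} {x : E} (h : HolomorphicGerm X f x) :
    ∀ᶠ y in 𝓝[X] x, HolomorphicGerm X f y := by
  obtain ⟨g, hg, hfg⟩ := h
  filter_upwards [eventually_eventually_nhdsWithin.2 hfg,
    hg.eventually_analyticAt.filter_mono nhdsWithin_le_nhds] with y h1 h2
  exact ⟨g, h2, h1⟩

/-- A family of germs along the restriction to `T` of the curve `δ` is a continuation. -/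
def ContinuesOn (X : Set E) (δ : unitInterval → E) (T : Set unitInterval)
    (F : unitInterval → E → ℂ) : Prop :=
  (∀ t ∈ T, HolomorphicGerm X (F t) (δ t)) ∧
    ∀ t ∈ T, ∀ᶠ s in 𝓝[T] t, F s =ᶠ[𝓝[X] (δ s)] F t

theorem ContinuesOn.mono {X : Set E} {δ : unitInterval → E} {S T : Set unitInterval}
    {F : unitInterval → E → ℂ} (h : ContinuesOn X δ T F) (hS : S ⊆ T) : ContinuesOn X δ S F :=
  ⟨fun t ht => h.1 t (hS ht), fun t ht => (h.2 t (hS ht)).filter_mono (nhdsWithin_mono _ hS)⟩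

/-- By the identity principle, agreement of the two families is locally constant in the parameter. A
general `T` is allowed because homotopy invariance needs the statement on short subintervals. -/
theorem ContinuesOn.eventuallyEq {X U : Set E} (hU : IdentityPrinciple X U) (hUX : U ⊆ X)
    {δ : unitInterval → E} (hδ : Continuous δ) (hδU : ∀ t, δ t ∈ U) {T : Set unitInterval}
    (hT : IsPreconnected T) {F F' : unitInterval → E → ℂ} (h : ContinuesOn X δ T F)
    (h' : ContinuesOn X δ T F') {a b : unitInterval} (ha : a ∈ T) (hb : b ∈ T)
    (hab : F a =ᶠ[𝓝[X] (δ a)] F' a) : F b =ᶠ[𝓝[X] (δ b)] F' b := by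
  refine hT.of_eventually_iff (P := fun t => F t =ᶠ[𝓝[X] (δ t)] F' t) ?_ ha hb hab
  intro t ht
  have h1 := (tendsto_nhdsWithin_of_continuous hδ (fun t => hUX (hδU t)) t).eventually
    (hU _ (hδU t) _ _ (h.1 t ht) (h'.1 t ht))
  filter_upwards [h.2 t ht, h'.2 t ht, h1.filter_mono nhdsWithin_le_nhds] with s h2 h3 h4
  exact ⟨fun e => h4.1 (h2.symm.trans (e.trans h3)), fun e => h2.trans ((h4.2 e).trans h3.symm)⟩

variable {X U : Set E} {x y z : U}

theorem isContinuation_iff {δ : Path x y} {f : Germ (𝓝[X] (x : E)) ℂ}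
    {g : Germ (𝓝[X] (y : E)) ℂ} :
    IsContinuation X δ f g ↔ ∃ F, ContinuesOn X (fun t => (δ t : E)) Set.univ F ∧
      (F 0 : Germ (𝓝[X] (x : E)) ℂ) = f ∧ (F 1 : Germ (𝓝[X] (y : E)) ℂ) = g := by
  simp [IsContinuation, ContinuesOn, and_assoc]

theorem IsContinuation.unique (hU : IdentityPrinciple X U) (hUX : U ⊆ X) {δ : Path x y}
    {f : Germ (𝓝[X] (x : E)) ℂ} {g g' : Germ (𝓝[X] (y : E)) ℂ} (h : IsContinuation X δ f g)
    (h' : IsContinuation X δ f g') : g = g' := by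
  obtain ⟨F, hF, rfl, rfl⟩ := isContinuation_iff.1 h
  obtain ⟨F', hF', h0, rfl⟩ := isContinuation_iff.1 h'
  have h0' := Germ.coe_eq.1 h0.symm
  have := hF.eventuallyEq hU hUX (continuous_coe_path δ) (fun t => (δ t).2)
    isPreconnected_univ hF' (Set.mem_univ 0) (Set.mem_univ 1) (by simpa using h0')
  exact Germ.coe_eq.2 (by simpa using this)

/-- Homotopy invariance of analytic continuation: the germs that result from continuation along
the paths of a homotopy with fixed end points do not depend on the path. -/
theorem IsContinuation.eq_of_homotopic (hU : IdentityPrinciple X U) (hUX : U ⊆ X)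
    {δ δ' : Path x y} (hδ : δ.Homotopic δ') {f : Germ (𝓝[X] (x : E)) ℂ}
    (hf : ∀ ε : Path x y, ∃ g, IsContinuation X ε f g) {g g' : Germ (𝓝[X] (y : E)) ℂ}
    (h : IsContinuation X δ f g) (h' : IsContinuation X δ' f g') : g = g' := by
  obtain ⟨H⟩ := hδ
  choose G hG using fun s => hf (H.eval s)
  choose F hF hF0 hF1 using fun s => isContinuation_iff.1 (hG s)
  let K : unitInterval × unitInterval → E := fun p => (H p : E)
  have hKc : Continuous K := continuous_subtype_val.comp H.continuous
  have hKX : ∀ p, K p ∈ X := fun p => hUX (H p).2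
  have hK0 : ∀ s, K (s, 0) = x := fun s => by simp [K]
  have hK1 : ∀ s, K (s, 1) = y := fun s => by simp [K]
  have hFK : ∀ s, ContinuesOn X (fun t => K (s, t)) Set.univ (F s) := hF
  have hKs : ∀ s, Continuous fun t => K (s, t) := fun s => by fun_prop
  have hKt : ∀ t, Continuous fun s => K (s, t) := fun s => by fun_prop
  -- The final germ is locally constant in `s`. For fixed `s`, `P t` says that the germs at time `t`
  -- on neighbouring paths come from the one function `F s t`; it is propagated from `t = 0` to `t =
  -- 1`.
  have near : ∀ s, ∀ᶠ s' in 𝓝 s, G s' = G s := by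
    intro s
    let P : unitInterval → Prop := fun t => ∀ᶠ s' in 𝓝 s, F s' t =ᶠ[𝓝[X] (K (s', t))] F s t
    -- Near `(s, t₀)` the single function `F s t₀` is holomorphic at every `K (s', t)`, and it
    -- represents `F s t` for `t` near `t₀`.
    have box : ∀ t₀, ∃ T ∈ 𝓝 t₀, ∀ a ∈ T, ∀ b ∈ T, P a → P b := by
      intro t₀
      have e1 := (tendsto_nhdsWithin_of_continuous hKc hKX (s, t₀)).eventually
        ((hFK s).1 t₀ trivial).eventually
      rw [nhds_prod_eq] at e1
      obtain ⟨p, hp, q, hq, hpq⟩ := eventually_prod_iff.1 e1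
      have e2 := (hFK s).2 t₀ trivial
      rw [nhdsWithin_univ] at e2
      obtain ⟨a, b, -, hT, hTs⟩ := exists_Icc_mem_subset_of_mem_nhds (hq.and e2)
      have hTc : IsPreconnected (Set.Icc a b) := isPreconnected_Icc
      set T := Set.Icc a b
      have e3 : ∀ t ∈ T, ∀ᶠ s' in 𝓝 s, F s t =ᶠ[𝓝[X] (K (s', t))] F s t₀ := fun t ht =>
        (tendsto_nhdsWithin_of_continuous (hKt t) (fun _ => hKX _) s).eventually
          (eventually_eventually_nhdsWithin.2 (hTs ht).2)
      refine ⟨T, hT, fun a ha b hb hPa => ?_⟩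
      filter_upwards [hPa, e3 a ha, e3 b hb, hp] with s' h1 h2 h3 h4
      refine EventuallyEq.trans ?_ h3.symm
      -- The constant family `F s t₀` is itself a continuation along the piece of the path `s'` over
      -- `T`, so agreement at `a` passes to `b` by uniqueness.
      exact ((hFK s').mono (Set.subset_univ T)).eventuallyEq hU hUX (hKs s')
        (fun t => (H (s', t)).2) hTc (F' := fun _ => F s t₀)
        ⟨fun t ht => hpq h4 (hTs ht).1, fun t _ => .of_forall fun _ => EventuallyEq.rfl⟩
        ha hb (h1.trans h2)
    have hP : P 1 := by
      refine isPreconnected_univ.of_eventually_iff (P := P) (a := 0) ?_ trivial trivial ?_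
      · intro t _
        obtain ⟨T, hT, h⟩ := box t
        rw [nhdsWithin_univ]
        filter_upwards [hT] with a ha
        exact ⟨h a ha t (mem_of_mem_nhds hT), h t (mem_of_mem_nhds hT) a ha⟩
      · refine .of_forall fun s' => ?_
        rw [hK0]
        exact Germ.coe_eq.1 ((hF0 s').trans (hF0 s).symm)
    filter_upwards [hP] with s' hs'
    rw [hK1] at hs'
    rw [← hF1 s, ← hF1 s']
    exact Germ.coe_eq.2 hs'
  have h01 : G 1 = G 0 :=
    isPreconnected_univ.of_eventually_iff (P := fun s => G s = G 0) (a := 0)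
      (fun s _ => by
        rw [nhdsWithin_univ]
        filter_upwards [near s] with s' hs'
        rw [hs']) trivial trivial rfl
  have k0 := hG 0
  have k1 := hG 1
  rw [H.eval_zero] at k0
  rw [H.eval_one] at k1
  rw [h.unique hU hUX k0, h'.unique hU hUX k1, h01]

/-! ### Concatenating and splitting continuations -/

theorem ContinuesOn.comp {δ : unitInterval → E} {F : unitInterval → E → ℂ}
    (h : ContinuesOn X δ Set.univ F) {φ : unitInterval → unitInterval} (hφ : Continuous φ) :
    ContinuesOn X (δ ∘ φ) Set.univ (F ∘ φ) := by
  refine ⟨fun t _ => h.1 (φ t) trivial, fun t _ => ?_⟩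
  have := h.2 (φ t) trivial
  rw [nhdsWithin_univ] at this ⊢
  exact hφ.continuousAt.eventually this

theorem ContinuesOn.glue {δ δ' : unitInterval → E} (hδ' : Continuous δ')
    (hX : ∀ t, δ' t ∈ X) {F F' : unitInterval → E → ℂ}
    (h : ContinuesOn X δ Set.univ F) (h' : ContinuesOn X δ' Set.univ F') {c : unitInterval}
    (hc : δ c = δ' c) (hF : F c =ᶠ[𝓝[X] (δ' c)] F' c) :
    ContinuesOn X (fun t => if t ≤ c then δ t else δ' t) Set.univ
      (fun t => if t ≤ c then F t else F' t) := by
  obtain ⟨h1, h2⟩ := h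
  obtain ⟨h1', h2'⟩ := h'
  simp only [nhdsWithin_univ] at h2 h2'
  refine ⟨fun t _ => ?_, fun t _ => ?_⟩
  · dsimp only
    split_ifs
    exacts [h1 t trivial, h1' t trivial]
  · rw [nhdsWithin_univ]
    rcases lt_trichotomy t c with ht | rfl | ht
    · filter_upwards [h2 t trivial, eventually_lt_nhds ht] with s hs hsc
      simpa only [if_pos hsc.le, if_pos ht.le] using hs
    · have e := (tendsto_nhdsWithin_of_continuous hδ' hX t).eventually
        (eventually_eventually_nhdsWithin.2 hF)
      filter_upwards [h2 t trivial, h2' t trivial, e] with s hs hs' he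
      by_cases hst : s ≤ t
      · simpa only [if_pos hst, if_pos le_rfl] using hs
      · simpa only [if_neg hst, if_pos le_rfl] using hs'.trans (EventuallyEq.symm he)
    · filter_upwards [h2' t trivial, eventually_gt_nhds ht] with s hs hsc
      simpa only [if_neg hsc.not_ge, if_neg ht.not_ge] using hs

theorem IsContinuation.trans (hUX : U ⊆ X) {δ : Path x y} {δ' : Path y z}
    {f : Germ (𝓝[X] (x : E)) ℂ} {g : Germ (𝓝[X] (y : E)) ℂ} {h : Germ (𝓝[X] (z : E)) ℂ}
    (h₁ : IsContinuation X δ f g) (h₂ : IsContinuation X δ' g h) :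
    IsContinuation X (δ.trans δ') f h := by
  obtain ⟨F, hF, rfl, rfl⟩ := isContinuation_iff.1 h₁
  obtain ⟨F', hF', hg, rfl⟩ := isContinuation_iff.1 h₂
  -- Clamping makes both reparametrizations total and continuous; they take the values `1` and `0`
  -- at the junction `c`.
  let a : unitInterval → unitInterval := fun t => Set.projIcc 0 1 zero_le_one (2 * (t : ℝ))
  let b : unitInterval → unitInterval := fun t => Set.projIcc 0 1 zero_le_one (2 * (t : ℝ) - 1)
  have ha : Continuous a := continuous_projIcc.comp (by fun_prop)
  have hb : Continuous b := continuous_projIcc.comp (by fun_prop)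
  let c : unitInterval := ⟨1 / 2, by norm_num, by norm_num⟩
  have ac : a c = 1 := Set.projIcc_of_right_le _ (by norm_num [c])
  have bc : b c = 0 := Set.projIcc_of_le_left _ (by norm_num [c])
  have a0 : a 0 = 0 := Set.projIcc_of_le_left _ (by norm_num)
  have b1 : b 1 = 1 := Set.projIcc_of_right_le _ (by norm_num)
  have key := (hF.comp ha).glue ((continuous_coe_path δ').comp hb) (fun t => hUX (δ' (b t)).2)
    (hF'.comp hb) (c := c) (by simp [ac, bc]) (by
      have := Germ.coe_eq.1 hg.symm
      simpa [ac, bc] using this)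
  refine isContinuation_iff.2
    ⟨fun t => if t ≤ c then (F ∘ a) t else (F' ∘ b) t, ?_, ?_, ?_⟩
  · refine (congrArg (fun e => ContinuesOn X e Set.univ _) (funext fun t => ?_)).mp key
    rw [Path.trans_apply]
    by_cases ht : t ≤ c
    · have ht' : (t : ℝ) ≤ 1 / 2 := ht
      rw [if_pos ht, dif_pos ht']
      simp only [Function.comp_apply]
      congr 2
      exact Set.projIcc_of_mem _ _
    · have ht' : ¬ (t : ℝ) ≤ 1 / 2 := ht
      rw [if_neg ht, dif_neg ht']
      simp only [Function.comp_apply]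
      congr 2
      exact Set.projIcc_of_mem _ _
  · have h0 : (0 : unitInterval) ≤ c := unitInterval.nonneg'
    simp [h0, a0]
  · have h1 : ¬ (1 : unitInterval) ≤ c := by
      rw [not_le, ← Subtype.coe_lt_coe]
      norm_num [c]
    simp [h1, b1]

theorem IsContinuation.of_trans {δ : Path x y} {δ' : Path y z}
    {f : Germ (𝓝[X] (x : E)) ℂ} {h : Germ (𝓝[X] (z : E)) ℂ}
    (H : IsContinuation X (δ.trans δ') f h) :
    ∃ g, IsContinuation X δ f g ∧ IsContinuation X δ' g h := by
  obtain ⟨F, hF, rfl, rfl⟩ := isContinuation_iff.1 H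
  let a : unitInterval → unitInterval := fun t =>
    ⟨(t : ℝ) / 2, by linarith [t.2.1], by linarith [t.2.2]⟩
  let b : unitInterval → unitInterval := fun t =>
    ⟨((t : ℝ) + 1) / 2, by linarith [t.2.1], by linarith [t.2.2]⟩
  have a0 : a 0 = 0 := by ext; simp [a]
  have b0 : b 0 = a 1 := by ext; simp [a, b]
  have b1 : b 1 = 1 := by ext; norm_num [b]
  have ha : ∀ t, (δ.trans δ') (a t) = δ t := fun t => by
    have ht : ((a t : unitInterval) : ℝ) ≤ 1 / 2 := by
      have := t.2.2
      simp only [a]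
      linarith
    rw [Path.trans_apply, dif_pos ht]
    congr 1
    ext
    simp only [a]
    ring
  have hb : ∀ t, (δ.trans δ') (b t) = δ' t := fun t => by
    rw [Path.trans_apply]
    split_ifs with ht
    -- The midpoint falls into the first branch of `Path.trans`, so `t = 0` needs `δ.target`.
    · have h0 : t = 0 := by
        ext
        have := t.2.1
        simp only [b] at ht
        simp only [Set.Icc.coe_zero]
        linarith
      subst h0
      rw [δ'.source]
      convert δ.target using 2
      ext
      norm_num [b]
    · congr 1
      ext
      simp only [b]
      ring
  refine ⟨(F (a 1) : Germ (𝓝[X] (y : E)) ℂ), isContinuation_iff.2 ⟨F ∘ a, ?_, ?_, rfl⟩,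
    isContinuation_iff.2 ⟨F ∘ b, ?_, ?_, ?_⟩⟩
  · have := hF.comp (φ := a) (by fun_prop)
    simpa only [Function.comp_def, ha] using this
  · simp [a0]
  · have := hF.comp (φ := b) (by fun_prop)
    simpa only [Function.comp_def, hb] using this
  · simp [b0]
  · simp [b1]

/-! ### Monodromy operators -/

theorem monodromy_spec {δ : Path x x} {f : Germ (𝓝[X] (x : E)) ℂ} (hf : f ∈ multivalued X x) :
    IsContinuation X δ f (monodromy X δ f) :=
  Classical.epsilon_spec (hf x δ)

theorem IsContinuation.eq_monodromy (hU : IdentityPrinciple X U) (hUX : U ⊆ X) {δ : Path x x}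
    {f g : Germ (𝓝[X] (x : E)) ℂ} (h : IsContinuation X δ f g) : g = monodromy X δ f :=
  h.unique hU hUX (Classical.epsilon_spec ⟨g, h⟩)

/-- Continue `f` along `δ` followed by `δ'` and split: by uniqueness the germ in the middle is the
monodromy of `f`. -/
theorem monodromy_mem_multivalued (hU : IdentityPrinciple X U) (hUX : U ⊆ X) (δ : Path x x)
    {f : Germ (𝓝[X] (x : E)) ℂ} (hf : f ∈ multivalued X x) :
    monodromy X δ f ∈ multivalued X x := by
  intro y δ'
  obtain ⟨h, hh⟩ := hf y (δ.trans δ')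
  obtain ⟨g, hg, hgh⟩ := hh.of_trans
  exact ⟨h, hg.eq_monodromy hU hUX ▸ hgh⟩

theorem monodromy_monodromy (hU : IdentityPrinciple X U) (hUX : U ⊆ X) {α β γ : Path x x}
    (hγ : (β.trans α).Homotopic γ) {f : Germ (𝓝[X] (x : E)) ℂ} (hf : f ∈ multivalued X x) :
    monodromy X α (monodromy X β f) = monodromy X γ f :=
  IsContinuation.eq_of_homotopic hU hUX hγ (hf x)
    ((monodromy_spec hf).trans hUX
      (monodromy_spec (monodromy_mem_multivalued hU hUX β hf)))
    (monodromy_spec hf)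

end Continuation

/-! ### The identity principle near a tangential intersection -/

namespace TangentialChart

variable {E : Type*} [NormedAddCommGroup E] [NormedSpace ℂ E] {X P P' : Set E} {k : ℕ}

/-- This identifies germs on `X` with germs on an open set of the coordinate space, where the usual
identity theorem is available. -/
theorem map_param_nhds (c : TangentialChart X P P' k) {x : E} (hx : x ∈ X ∩ c.source) :
    map c.param (𝓝 (c.coord x)) = 𝓝[X] x := by
  have hz := c.coord_mem x hx
  apply le_antisymm
  · refine tendsto_nhdsWithin_iff.2 ⟨?_, ?_⟩
    · have := (c.analytic_param _ hz).continuousAt.tendsto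
      rwa [c.param_coord x hx] at this
    · filter_upwards [c.isOpen_target.mem_nhds hz] with z h
      exact (c.param_mem z h).1
  · have h1 : Tendsto c.coord (𝓝[X] x) (𝓝 (c.coord x)) :=
      (c.analytic_coord x hx.2).continuousAt.tendsto.mono_left nhdsWithin_le_nhds
    have h2 : ∀ᶠ y in 𝓝[X] x, c.param (c.coord y) = y := by
      filter_upwards [self_mem_nhdsWithin,
        nhdsWithin_le_nhds (c.isOpen_source.mem_nhds hx.2)] with y hy hy'
      exact c.param_coord y ⟨hy, hy'⟩
    calc 𝓝[X] x = map (fun y => c.param (c.coord y)) (𝓝[X] x) := by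
          rw [map_congr h2, map_id']
      _ = map c.param (map c.coord (𝓝[X] x)) := Filter.map_map.symm
      _ ≤ map c.param (𝓝 (c.coord x)) := map_mono h1

theorem eventuallyEq_iff (c : TangentialChart X P P' k) {x : E} (hx : x ∈ X ∩ c.source)
    {f g : E → ℂ} :
    f =ᶠ[𝓝[X] x] g ↔ (f ∘ c.param) =ᶠ[𝓝 (c.coord x)] (g ∘ c.param) := by
  rw [← c.map_param_nhds hx]
  exact eventually_map

theorem analyticAt_comp_param (c : TangentialChart X P P' k) {x : E} (hx : x ∈ X ∩ c.source)
    {f : E → ℂ} (hf : HolomorphicGerm X f x) : AnalyticAt ℂ (f ∘ c.param) (c.coord x) := by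
  obtain ⟨g, hg, hfg⟩ := hf
  refine AnalyticAt.congr ?_ ((c.eventuallyEq_iff hx).1 hfg).symm
  refine AnalyticAt.comp ?_ (c.analytic_param _ (c.coord_mem x hx))
  rwa [c.param_coord x hx]

/-- On a small ball in the coordinates both functions are analytic; the ball is connected, so
agreement near one of its points gives agreement near all of them. -/
theorem identityPrinciple (c : TangentialChart X P P' k) :
    IdentityPrinciple X c.complement := by
  intro x hx f g hf hg
  have hx := hx.1
  obtain ⟨ρ, hρ, hb⟩ := Metric.eventually_nhds_iff_ball.1
    ((c.analyticAt_comp_param hx hf).eventually_analyticAt.and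
      (c.analyticAt_comp_param hx hg).eventually_analyticAt)
  have hpc : IsPreconnected (Metric.ball (c.coord x) ρ) := (convex_ball _ _).isPreconnected
  have key : ∀ z ∈ Metric.ball (c.coord x) ρ, ∀ w ∈ Metric.ball (c.coord x) ρ,
      (f ∘ c.param) =ᶠ[𝓝 z] (g ∘ c.param) → (f ∘ c.param) =ᶠ[𝓝 w] (g ∘ c.param) :=
    fun z hz w hw h => (AnalyticOnNhd.eqOn_of_preconnected_of_eventuallyEq
      (fun z hz => (hb z hz).1) (fun z hz => (hb z hz).2) hpc hz h).eventuallyEq_of_mem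
      (Metric.isOpen_ball.mem_nhds hw)
  have h1 : Tendsto c.coord (𝓝[X] x) (𝓝 (c.coord x)) :=
    (c.analytic_coord x hx.2).continuousAt.tendsto.mono_left nhdsWithin_le_nhds
  filter_upwards [self_mem_nhdsWithin, nhdsWithin_le_nhds (c.isOpen_source.mem_nhds hx.2),
    h1 (Metric.ball_mem_nhds _ hρ)] with y hy hy' hyb
  rw [c.eventuallyEq_iff ⟨hy, hy'⟩, c.eventuallyEq_iff hx]
  exact ⟨key _ hyb _ (Metric.mem_ball_self hρ), key _ (Metric.mem_ball_self hρ) _ hyb⟩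

end TangentialChart

end Pham

theorem theorem3 (D : ℕ) (G : Pham.FeynmanGraph) (κ κ' : Set G.IntEdge) (k : ℕ)
    (c : Pham.TangentialChart (G.externalSpace D) (G.phamLocus D κ) (G.phamLocus D κ') k)
    (r : ℝ) (hr : c.Fits r)
    (ηp ηm : Path (c.base hr) (c.base hr))
    (hηp : Path.Homotopic (ηp.trans (c.etaPlus hr)) (c.gamma hr))
    (hηm : Path.Homotopic (ηm.trans (c.etaMinus hr)) (c.gamma hr)) :
    -- the relations in the complement of the line and the parabola in the plane
    (∀ (s : ℝ) (hs : 0 < s),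
      Pham.ConjRel ((Pham.modelGamma hs).map (Pham.modelIncl s).continuous)
        ((Pham.modelEtaPlus hs).map (Pham.modelIncl s).continuous)
        ((Pham.modelEtaMinus hs).map (Pham.modelIncl s).continuous) ∧
      Pham.ConjRel ((Pham.modelGamma hs).map (Pham.modelIncl s).continuous)
        ((Pham.modelEtaMinus hs).map (Pham.modelIncl s).continuous)
        ((Pham.modelEtaPlus hs).map (Pham.modelIncl s).continuous)) ∧
    -- the relations near the intersection of the two loci
    Pham.ConjRel (c.gamma hr) (c.etaPlus hr) (c.etaMinus hr) ∧
    Pham.ConjRel (c.gamma hr) (c.etaMinus hr) (c.etaPlus hr) ∧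
    Path.Homotopic ((c.etaMinus hr).trans ηp) (c.gamma hr) ∧
    Path.Homotopic ((c.etaPlus hr).trans ηm) (c.gamma hr) ∧
    -- the monodromy operators are well defined on the multivalued functions
    (∀ f ∈ Pham.multivalued (G.externalSpace D) (c.base hr),
      ∀ δ : Path (c.base hr) (c.base hr),
        Pham.IsContinuation (G.externalSpace D) δ f
          (Pham.monodromy (G.externalSpace D) δ f) ∧
        (∀ g, Pham.IsContinuation (G.externalSpace D) δ f g →
          g = Pham.monodromy (G.externalSpace D) δ f) ∧
        Pham.monodromy (G.externalSpace D) δ f ∈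
          Pham.multivalued (G.externalSpace D) (c.base hr)) ∧
    -- the relations of the monodromies, for all multivalued functions
    (∀ f ∈ Pham.multivalued (G.externalSpace D) (c.base hr),
      let M := fun δ : Path (c.base hr) (c.base hr) => Pham.monodromy (G.externalSpace D) δ
      M (c.etaPlus hr) (M ηp f) = M (c.etaMinus hr) (M ηm f) ∧
      M (c.etaMinus hr) (M ηm f) = M ηp (M (c.etaMinus hr) f) ∧
      M ηp (M (c.etaMinus hr) f) = M ηm (M (c.etaPlus hr) f)) ∧
    -- and in particular for the branches of the Feynman integral
    (∀ f, G.IsFeynmanBranch (c.base hr : G.ExtEdge → Fin (D + 1) → ℂ) f →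
      f ∈ Pham.multivalued (G.externalSpace D) (c.base hr) →
      let M := fun δ : Path (c.base hr) (c.base hr) => Pham.monodromy (G.externalSpace D) δ
      M (c.etaPlus hr) (M ηp f) = M (c.etaMinus hr) (M ηm f) ∧
      M (c.etaMinus hr) (M ηm f) = M ηp (M (c.etaMinus hr) f) ∧
      M ηp (M (c.etaMinus hr) f) = M ηm (M (c.etaPlus hr) f)) := by
  have hI := c.identityPrinciple
  have hX : c.complement ⊆ G.externalSpace D := fun _ hx => hx.1.1
  have hp := (Pham.conjRel_modelEtaPlus hr.1).map (c.embed hr)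
  have hm := (Pham.conjRel_modelEtaMinus hr.1).map (c.embed hr)
  -- The signs cross: the factorization through `η₊'` needs the conjugation that takes `η₋'` to
  -- `η₊'`.
  have hp' : Path.Homotopic ((c.etaMinus hr).trans ηp) (c.gamma hr) := hm.trans_homotopic hηp
  have hm' : Path.Homotopic ((c.etaPlus hr).trans ηm) (c.gamma hr) := hp.trans_homotopic hηm
  have hM : ∀ f ∈ Pham.multivalued (G.externalSpace D) (c.base hr),
      let M := fun δ : Path (c.base hr) (c.base hr) => Pham.monodromy (G.externalSpace D) δ
      M (c.etaPlus hr) (M ηp f) = M (c.etaMinus hr) (M ηm f) ∧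
      M (c.etaMinus hr) (M ηm f) = M ηp (M (c.etaMinus hr) f) ∧
      M ηp (M (c.etaMinus hr) f) = M ηm (M (c.etaPlus hr) f) := by
    intro f hf
    -- Each of the four products is rewritten to the monodromy along `γ`.
    simp only [Pham.monodromy_monodromy hI hX hηp hf, Pham.monodromy_monodromy hI hX hηm hf,
      Pham.monodromy_monodromy hI hX hp' hf, Pham.monodromy_monodromy hI hX hm' hf, and_self]
  exact ⟨fun s hs => ⟨(Pham.conjRel_modelEtaPlus hs).map (Pham.modelIncl s),
      (Pham.conjRel_modelEtaMinus hs).map (Pham.modelIncl s)⟩, hp, hm, hp', hm',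
    fun f hf δ => ⟨Pham.monodromy_spec hf, fun g hg => hg.eq_monodromy hI hX,
      Pham.monodromy_mem_multivalued hI hX δ hf⟩, hM, fun f _ hf => hM f hf⟩
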